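/- Let $\mathbb{N}=\{1,2,3,\dots\}$. For $A\subseteq\mathbb{N}$, real $x\ge 0$ and real $\alpha$ put $A(x)=|\{k\in A: k\le x\}|$ and $A_\alpha(n)=\sum_{k\in A,\,k\le n}k^\alpha$. Say that $A$ has asymptotic density $d(A)$ if $\liminf_{n\to\infty}\frac{A(n)}{n}=\limsup_{n\to\infty}\frac{A(n)}{n}=d(A)$, and let $\mathcal{D}$ be the class of all such sets. A density measure is a function $\mu$ from the set of all subsets of $\mathbb{N}$ to $[0,1]$ such that $\mu(A\cup B)=\mu(A)+\mu(B)$ for all disjoint $A,B\subseteq\mathbb{N}$ and $\mu(A)=d(A)$ for every $A\in\mathcal{D}$. **Theorem.** For every $A\subseteq\mathbb{N}$ the limits below exist and $$\sup\{\mu(A):\mu\text{ a density measure}\}=\inf\{d(B):A\subseteq B\in\mathcal{D}\}=\lim_{\alpha\to\infty}\limsup_{n\to\infty}\frac{A_\alpha(n)}{\mathbb{N}_\alpha(n)}=\lim_{\theta\to1^-}\limsup_{n\to\infty}\frac{A(n)-A(\theta n)}{n-\theta n},$$ $$\inf\{\mu(A):\mu\text{ a density measure}\}=\sup\{d(B):A\supseteq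 B\in\mathcal{D}\}=\lim_{\alpha\to\infty}\liminf_{n\to\infty}\frac{A_\alpha(n)}{\mathbb{N}_\alpha(n)}=\lim_{\theta\to1^-}\liminf_{n\to\infty}\frac{A(n)-A(\theta n)}{n-\theta n}.$$ Here $\alpha$ and $\theta$ range over real numbers and $n$ over positive integers, and the suprema and infima are taken over non-empty sets (in particular, density measures exist). -/

import Mathlib

open Filter Topology

noncomputable section

namespace DensityMeasure

/-- The counting function `A(x)`: the number of elements of `A` that are at most `x`
(here `x` is real, since `A(θ n)` is needed for real `θ`). -/
def count (A : Set ℕ+) (x : ℝ) : ℕ :=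
  Set.ncard {k : ℕ+ | k ∈ A ∧ (k : ℝ) ≤ x}

/-- Upper asymptotic density. The quotients lie in `[0, 1]`. -/
def upperDensity (A : Set ℕ+) : ℝ :=
  limsup (fun n : ℕ+ => (count A (n : ℝ) : ℝ) / (n : ℝ)) atTop

/-- Lower asymptotic density. -/
def lowerDensity (A : Set ℕ+) : ℝ :=
  liminf (fun n : ℕ+ => (count A (n : ℝ) : ℝ) / (n : ℝ)) atTop

/-- `A` possesses asymptotic density. -/
def HasDensity (A : Set ℕ+) : Prop :=
  lowerDensity A = upperDensity A

/-- The asymptotic density `d(A)`; used only for sets with `HasDensity A`. -/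
def density (A : Set ℕ+) : ℝ :=
  upperDensity A

/-- Density measures: finitely additive `[0, 1]`-valued set functions, defined on all sets of
positive integers, which extend the asymptotic density (in particular the whole set has
measure `1`). -/
structure IsDensityMeasure (μ : Set ℕ+ → ℝ) : Prop where
  mem_unit (A : Set ℕ+) : μ A ∈ Set.Icc (0 : ℝ) 1
  additive (A B : Set ℕ+) : Disjoint A B → μ (A ∪ B) = μ A + μ B
  extends_density (A : Set ℕ+) : HasDensity A → μ A = density A

/-- `A_α(n)`, the sum of `k ^ α` over all `k ∈ A` with `k ≤ n`. -/
def powSum (α : ℝ) (A : Set ℕ+) (n : ℕ+) : ℝ :=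
  ∑ k ∈ Finset.Icc 1 n, A.indicator (fun k : ℕ+ => (k : ℝ) ^ α) k

/-- Upper `α`-density. The quotients lie in `[0, 1]`. -/
def upperAlphaDensity (α : ℝ) (A : Set ℕ+) : ℝ :=
  limsup (fun n : ℕ+ => powSum α A n / powSum α Set.univ n) atTop

/-- Lower `α`-density. -/
def lowerAlphaDensity (α : ℝ) (A : Set ℕ+) : ℝ :=
  liminf (fun n : ℕ+ => powSum α A n / powSum α Set.univ n) atTop

/-- The quotient `(A(n) - A(θ n)) / (n - θ n)`. For fixed `θ < 1` it is bounded in `n`. -/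
def polyaQuotient (θ : ℝ) (A : Set ℕ+) (n : ℕ+) : ℝ :=
  ((count A (n : ℝ) : ℝ) - (count A (θ * (n : ℝ)) : ℝ)) / ((n : ℝ) - θ * (n : ℝ))

/-- The function of `θ` whose limit at `1` from the left is the upper Pólya density. -/
def upperPolya (θ : ℝ) (A : Set ℕ+) : ℝ :=
  limsup (fun n : ℕ+ => polyaQuotient θ A n) atTop

/-- The function of `θ` whose limit at `1` from the left is the lower Pólya density. -/
def lowerPolya (θ : ℝ) (A : Set ℕ+) : ℝ :=
  liminf (fun n : ℕ+ => polyaQuotient θ A n) atTop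

end DensityMeasure

end

noncomputable section

namespace DensityMeasure

/-! Every upper quantity equals one number u, `unifDensity A`: the least u for which A has at most
u(n - m) + o(n) elements in (m, n], uniformly in m. The o(n) is written as "δn + C for every δ", so
small n need no separate treatment. If A lies in a set B of density d, subtracting counts at m and n
gives d ≥ u; a greedy enlargement of A attains d = u (`exists_superset_hasDensityValue`), and
monotonicity gives μ(A) ≤ u. For v < u the bound fails on intervals whose lengths tend to infinity
and are comparable to their right ends, so an ultrafilter limit of frequencies along them is a
density measure with μ(A) ≥ v. Pólya and α-quotients are averages of tail counts, hence have limsup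
at most u. Conversely, if such a limsup is below v, then A satisfies the uniform bound for v up to
an error (1 - θ)n or vn/(α + 1), negligible in the limit. Complements give the lower half. -/

/-- The indicator of `A`, shifted so that it is indexed by `0, 1, 2, …`. -/
def ind (A : Set ℕ+) (k : ℕ) : ℝ := A.indicator (fun _ => (1 : ℝ)) k.succPNat

/-- The number of elements of `A` that are at most the natural number `n`, as a real. -/
def cnt (A : Set ℕ+) (n : ℕ) : ℝ := ∑ k ∈ Finset.range n, ind A k

/-- The `α`-weighted number of elements of `A` that are at most `n`. -/
def wcnt (α : ℝ) (A : Set ℕ+) (n : ℕ) : ℝ :=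
  ∑ k ∈ Finset.range n, ind A k * ((k : ℝ) + 1) ^ α

/-! ### Elementary properties of the indicator and counting functions -/

lemma ind_nonneg (A : Set ℕ+) (k : ℕ) : 0 ≤ ind A k :=
  Set.indicator_nonneg (fun _ _ => zero_le_one) _

lemma ind_compl (A : Set ℕ+) (k : ℕ) : ind Aᶜ k = 1 - ind A k := by
  classical
  simp only [ind, Set.indicator_apply, Set.mem_compl_iff]
  split_ifs <;> norm_num

lemma ind_univ (k : ℕ) : ind Set.univ k = 1 := by simp [ind]

lemma ind_mono {A B : Set ℕ+} (h : A ⊆ B) (k : ℕ) : ind A k ≤ ind B k :=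
  Set.indicator_le_indicator_of_subset h (fun _ => zero_le_one) _

lemma ind_union {A B : Set ℕ+} (h : Disjoint A B) (k : ℕ) :
    ind (A ∪ B) k = ind A k + ind B k :=
  congrFun (Set.indicator_union_of_disjoint h _) _

@[simp] lemma cnt_zero (A : Set ℕ+) : cnt A 0 = 0 := by simp [cnt]

lemma cnt_succ (A : Set ℕ+) (n : ℕ) : cnt A (n + 1) = cnt A n + ind A n :=
  Finset.sum_range_succ _ _

lemma cnt_compl (A : Set ℕ+) (n : ℕ) : cnt Aᶜ n = n - cnt A n := by
  simp [cnt, ind_compl]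

lemma cnt_univ (n : ℕ) : cnt Set.univ n = n := by
  simp [cnt, ind_univ]

lemma cnt_union {A B : Set ℕ+} (h : Disjoint A B) (n : ℕ) :
    cnt (A ∪ B) n = cnt A n + cnt B n := by
  simp [cnt, ind_union h, Finset.sum_add_distrib]

lemma cnt_mono (A : Set ℕ+) {m n : ℕ} (h : m ≤ n) : cnt A m ≤ cnt A n :=
  monotone_nat_of_le_succ (fun k => by rw [cnt_succ]; linarith [ind_nonneg A k]) h

lemma cnt_nonneg (A : Set ℕ+) (n : ℕ) : 0 ≤ cnt A n :=
  Finset.sum_nonneg fun _ _ => ind_nonneg _ _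

lemma cnt_sub_le_of_subset {A B : Set ℕ+} (hAB : A ⊆ B) {m n : ℕ} (h : m ≤ n) :
    cnt A n - cnt A m ≤ cnt B n - cnt B m := by
  have := monotone_nat_of_le_succ (f := fun k => cnt B k - cnt A k)
    (fun k => by simp only [cnt_succ]; linarith [ind_mono hAB k]) h
  simp only at this
  linarith

lemma cnt_sub_le (A : Set ℕ+) {m n : ℕ} (h : m ≤ n) : cnt A n - cnt A m ≤ n - m := by
  simpa [cnt_univ] using cnt_sub_le_of_subset (Set.subset_univ A) h

lemma cnt_le (A : Set ℕ+) (n : ℕ) : cnt A n ≤ n := by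
  simpa using cnt_sub_le A (Nat.zero_le n)

lemma count_eq_cnt (A : Set ℕ+) (x : ℝ) : (count A x : ℝ) = cnt A ⌊x⌋₊ := by
  classical
  have h : {k : ℕ+ | k ∈ A ∧ (k : ℝ) ≤ x} =
      ↑(((Finset.range ⌊x⌋₊).filter (fun k => k.succPNat ∈ A)).image Nat.succPNat) := by
    ext k
    simp only [Set.mem_ofPred_eq, Finset.coe_image, Set.mem_image, Finset.mem_coe,
      Finset.mem_filter, Finset.mem_range]
    constructor
    · rintro ⟨hk, hx⟩
      refine ⟨k.natPred, ⟨?_, by simpa using hk⟩, by simp⟩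
      have h1 : (k : ℕ) ≤ ⌊x⌋₊ := Nat.le_floor hx
      have h2 := k.natPred_add_one
      omega
    · rintro ⟨j, ⟨hj, hA⟩, rfl⟩
      refine ⟨hA, ?_⟩
      have : (j + 1 : ℕ) ≤ x := (Nat.le_floor_iff' (by omega)).1 hj
      simpa using this
  rw [count, h, Set.ncard_coe_finset, Finset.card_image_of_injective _ Nat.succPNat_injective]
  simp [cnt, ind, Set.indicator_apply, Finset.sum_boole]

lemma powSum_eq_wcnt (α : ℝ) (A : Set ℕ+) (n : ℕ+) : powSum α A n = wcnt α A n := by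
  classical
  rw [powSum, wcnt]
  refine Finset.sum_nbij' PNat.natPred Nat.succPNat ?_ ?_ (by simp) (by simp) ?_
  · intro k hk
    have h1 : (k : ℕ) ≤ n := (Finset.mem_Icc.1 hk).2
    have h2 := k.natPred_add_one
    rw [Finset.mem_range]
    omega
  · intro k hk
    rw [Finset.mem_range] at hk
    rw [Finset.mem_Icc]
    exact ⟨one_le, by rw [← PNat.coe_le_coe]; simpa using hk⟩
  · intro k _
    have h2 : (k.natPred : ℝ) + 1 = (k : ℝ) := by exact_mod_cast k.natPred_add_one
    rw [h2]
    simp only [ind, Set.indicator_apply, PNat.succPNat_natPred]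
    split_ifs <;> simp

/-! ### Limits superior and inferior along the positive integers -/

lemma limsup_le_of_forall_pos {f : ℕ+ → ℝ} {M v : ℝ} (hM : ∀ n, |f n| ≤ M)
    (h : ∀ ε > 0, ∀ᶠ n in atTop, f n ≤ v + ε) : limsup f atTop ≤ v := by
  refine le_of_forall_pos_le_add fun ε hε => limsup_le_of_le ?_ (h ε hε)
  exact (isBoundedUnder_of ⟨-M, fun n => (abs_le.1 (hM n)).1⟩ :
    IsBoundedUnder (· ≥ ·) atTop f).isCoboundedUnder_le

lemma isBoundedUnder_le_of_abs {f : ℕ+ → ℝ} {M : ℝ} (hM : ∀ n, |f n| ≤ M) :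
    IsBoundedUnder (· ≤ ·) atTop f :=
  isBoundedUnder_of ⟨M, fun n => (abs_le.1 (hM n)).2⟩

lemma isBoundedUnder_ge_of_abs {f : ℕ+ → ℝ} {M : ℝ} (hM : ∀ n, |f n| ≤ M) :
    IsBoundedUnder (· ≥ ·) atTop f :=
  isBoundedUnder_of ⟨-M, fun n => (abs_le.1 (hM n)).1⟩

/-- Transfers upper results for Aᶜ to lower results for A. The sum is only assumed to converge
because rounding θn perturbs the Pólya quotients. -/
lemma liminf_eq_sub_limsup {f g : ℕ+ → ℝ} {M N c : ℝ} (hf : ∀ n, |f n| ≤ M)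
    (hg : ∀ n, |g n| ≤ N) (h : Tendsto (fun n => f n + g n) atTop (𝓝 c)) :
    liminf g atTop = c - limsup f atTop := by
  apply le_antisymm
  · refine le_of_forall_pos_le_add fun ε hε => ?_
    have h1 : ∃ᶠ n in atTop, limsup f atTop - ε / 2 < f n :=
      frequently_lt_of_lt_limsup (isBoundedUnder_ge_of_abs hf).isCoboundedUnder_le (by linarith)
    have h2 : ∀ᶠ n in atTop, f n + g n < c + ε / 2 := h.eventually_lt_const (by linarith)
    refine liminf_le_of_frequently_le ((h1.and_eventually h2).mono fun n hn => ?_)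
      (isBoundedUnder_ge_of_abs hg)
    linarith [hn.1, hn.2]
  · rw [← sub_nonneg]
    refine le_of_forall_pos_le_add fun ε hε => ?_
    have h1 : ∀ᶠ n in atTop, f n < limsup f atTop + ε / 2 :=
      eventually_lt_of_limsup_lt (by linarith) (isBoundedUnder_le_of_abs hf)
    have h2 : ∀ᶠ n in atTop, c - ε / 2 < f n + g n := h.eventually_const_lt (by linarith)
    have h3 : c - limsup f atTop - ε ≤ liminf g atTop := by
      refine le_liminf_of_le (isBoundedUnder_le_of_abs hg).isCoboundedUnder_ge ?_
      filter_upwards [h1, h2] with n hn hn'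
      linarith
    linarith

lemma tendsto_pnat_cast : Tendsto (fun n : ℕ+ => (n : ℝ)) atTop atTop :=
  tendsto_natCast_atTop_atTop.comp tendsto_PNat_val_atTop_atTop

lemma pnat_cast_pos (n : ℕ+) : (0 : ℝ) < n := by exact_mod_cast n.pos

/-! ### Asymptotic density in terms of the counting function -/

/-- `cnt A n = d n + o(n)`. -/
def HasDensityValue (A : Set ℕ+) (d : ℝ) : Prop :=
  ∀ ε > 0, ∃ C : ℝ, ∀ n : ℕ, |cnt A n - d * n| ≤ ε * n + C

lemma abs_count_div_le (A : Set ℕ+) (n : ℕ+) : |(count A (n : ℝ) : ℝ) / (n : ℝ)| ≤ 1 := by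
  rw [count_eq_cnt, Nat.floor_natCast, abs_of_nonneg (div_nonneg (cnt_nonneg _ _) (by positivity))]
  exact div_le_one_of_le₀ (cnt_le A n) (by positivity)

lemma HasDensityValue.tendsto {A : Set ℕ+} {d : ℝ} (h : HasDensityValue A d) :
    Tendsto (fun n : ℕ+ => (count A (n : ℝ) : ℝ) / (n : ℝ)) atTop (𝓝 d) := by
  rw [Metric.tendsto_nhds]
  intro ε hε
  obtain ⟨C, hC⟩ := h (ε / 2) (by positivity)
  filter_upwards [tendsto_pnat_cast.eventually_gt_atTop (C / (ε / 2))] with n hn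
  have hn0 := pnat_cast_pos n
  rw [div_lt_iff₀ (by positivity)] at hn
  have h1 := hC n
  rw [Real.dist_eq, count_eq_cnt, Nat.floor_natCast, div_sub' hn0.ne', abs_div,
    abs_of_pos hn0, div_lt_iff₀ hn0, mul_comm (n : ℝ) d]
  linarith

lemma HasDensityValue.of_tendsto {A : Set ℕ+} {d : ℝ}
    (h : Tendsto (fun n : ℕ+ => (count A (n : ℝ) : ℝ) / (n : ℝ)) atTop (𝓝 d)) :
    HasDensityValue A d := by
  intro ε hε
  obtain ⟨N, hN⟩ := eventually_atTop.1 (Metric.tendsto_nhds.1 h ε hε)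
  refine ⟨(1 + |d|) * N, fun n => ?_⟩
  have hN0 := pnat_cast_pos N
  rcases lt_or_ge n (N : ℕ) with hn | hn
  · have h1 : (n : ℝ) ≤ N := by exact_mod_cast hn.le
    have h2 := cnt_le A n
    have h3 : |cnt A n| ≤ n := by rwa [abs_of_nonneg (cnt_nonneg _ _)]
    calc |cnt A n - d * n| ≤ |cnt A n| + |d * n| := abs_sub _ _
      _ = |cnt A n| + |d| * n := by rw [abs_mul, Nat.abs_cast]
      _ ≤ N + |d| * N := by gcongr; linarith
      _ = (1 + |d|) * N := by ring
      _ ≤ _ := by linarith [mul_nonneg hε.le (Nat.cast_nonneg (α := ℝ) n)]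
  · have hpos : 0 < n := N.pos.trans_le hn
    have h1 := hN ⟨n, hpos⟩ hn
    have hn0 : (0 : ℝ) < n := by exact_mod_cast hpos
    rw [Real.dist_eq, count_eq_cnt, PNat.mk_coe, Nat.floor_natCast, div_sub' hn0.ne', abs_div,
      abs_of_pos hn0, div_lt_iff₀ hn0, mul_comm (n : ℝ) d] at h1
    have : 0 ≤ (1 + |d|) * (N : ℝ) := by positivity
    linarith

lemma hasDensityValue_iff {A : Set ℕ+} {d : ℝ} :
    HasDensityValue A d ↔ HasDensity A ∧ density A = d := by
  constructor
  · intro h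
    exact ⟨h.tendsto.liminf_eq.trans h.tendsto.limsup_eq.symm, h.tendsto.limsup_eq⟩
  · rintro ⟨h, rfl⟩
    exact HasDensityValue.of_tendsto (tendsto_of_liminf_eq_limsup h rfl
      (isBoundedUnder_le_of_abs (abs_count_div_le A)) (isBoundedUnder_ge_of_abs (abs_count_div_le A)))

lemma HasDensityValue.compl {A : Set ℕ+} {d : ℝ} (h : HasDensityValue A d) :
    HasDensityValue Aᶜ (1 - d) := by
  intro ε hε
  obtain ⟨C, hC⟩ := h ε hε
  refine ⟨C, fun n => ?_⟩
  rw [cnt_compl, ← abs_neg]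
  convert hC n using 2
  ring

lemma hasDensityValue_univ : HasDensityValue Set.univ 1 :=
  fun ε hε => ⟨0, fun n => by rw [cnt_univ]; simp; positivity⟩

/-! ### The uniform upper density -/

/-- Up to `o(n)`, the set `A` has at most `u (n - m)` elements in `(m, n]`, uniformly in `m`. -/
def UnifBound (A : Set ℕ+) (u : ℝ) : Prop :=
  ∀ δ > 0, ∃ C : ℝ, ∀ m n : ℕ, m ≤ n → cnt A n - cnt A m ≤ u * (n - m) + δ * n + C

/-- The least `u` with `UnifBound A u`. -/
def unifDensity (A : Set ℕ+) : ℝ := sInf {u | UnifBound A u}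

lemma unifBound_one (A : Set ℕ+) : UnifBound A 1 := fun δ hδ => ⟨0, fun m n h => by
  have := cnt_sub_le A h
  have : 0 ≤ δ * (n : ℝ) := by positivity
  linarith⟩

lemma UnifBound.nonneg {A : Set ℕ+} {u : ℝ} (h : UnifBound A u) : 0 ≤ u := by
  by_contra! hu
  -- With m = 0 this δ turns the bound into un/2 + C, negative for large n.
  obtain ⟨C, hC⟩ := h (-u / 2) (by linarith)
  obtain ⟨n, hn⟩ := exists_nat_gt (C / (-u / 2))
  rw [div_lt_iff₀ (by linarith)] at hn
  have h1 := hC 0 n (Nat.zero_le n)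
  have h2 := cnt_nonneg A n
  simp only [cnt_zero, Nat.cast_zero] at h1
  linarith

lemma bddBelow_unifBound (A : Set ℕ+) : BddBelow {u | UnifBound A u} :=
  ⟨0, fun _ h => UnifBound.nonneg h⟩

/-- The infimum is attained: passing from a nearby v to it costs at most (δ/2)(n - m), which the
term δn absorbs. -/
lemma unifBound_unifDensity (A : Set ℕ+) : UnifBound A (unifDensity A) := by
  intro δ hδ
  obtain ⟨v, hv, hvu⟩ := Real.lt_sInf_add_pos (s := {u | UnifBound A u}) ⟨1, unifBound_one A⟩
    (half_pos hδ)
  obtain ⟨C, hC⟩ := hv (δ / 2) (half_pos hδ)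
  refine ⟨C, fun m n h => (hC m n h).trans ?_⟩
  change v < unifDensity A + δ / 2 at hvu
  have h1 : (m : ℝ) ≤ n := by exact_mod_cast h
  have h2 : (v - unifDensity A) * ((n : ℝ) - m) ≤ δ / 2 * (n - m) :=
    mul_le_mul_of_nonneg_right (by linarith) (by linarith)
  have h3 : 0 ≤ δ / 2 * (m : ℝ) := by positivity
  linarith

lemma unifDensity_nonneg (A : Set ℕ+) : 0 ≤ unifDensity A := (unifBound_unifDensity A).nonneg

lemma UnifBound.unifDensity_le {A : Set ℕ+} {u : ℝ} (h : UnifBound A u) : unifDensity A ≤ u :=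
  csInf_le (bddBelow_unifBound A) h

lemma unifDensity_le_one (A : Set ℕ+) : unifDensity A ≤ 1 := (unifBound_one A).unifDensity_le

lemma not_unifBound_of_lt {A : Set ℕ+} {v : ℝ} (h : v < unifDensity A) : ¬ UnifBound A v :=
  fun hv => h.not_ge hv.unifDensity_le

lemma HasDensityValue.unifBound {A B : Set ℕ+} {d : ℝ} (hAB : A ⊆ B) (h : HasDensityValue B d) :
    UnifBound A d := by
  intro δ hδ
  obtain ⟨C, hC⟩ := h (δ / 2) (half_pos hδ)
  refine ⟨2 * C, fun m n hmn => (cnt_sub_le_of_subset hAB hmn).trans ?_⟩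
  have h1 := (abs_le.1 (hC n)).2
  have h2 := (abs_le.1 (hC m)).1
  have h3 : δ / 2 * (m : ℝ) ≤ δ / 2 * n := by gcongr
  linarith

/-! ### A superset of `A` with density `unifDensity A` -/

open Classical in
/-- The counting function of `greedySuperset A u`. -/
def greedyCount (A : Set ℕ+) (u : ℝ) : ℕ → ℝ
  | 0 => 0
  | n + 1 => greedyCount A u n +
      if n.succPNat ∈ A ∨ greedyCount A u n + 1 ≤ u * (n + 1) then 1 else 0

/-- The superset of `A` obtained by adding `n` whenever this keeps the counting function at `n`
below `u n`. -/
def greedySuperset (A : Set ℕ+) (u : ℝ) : Set ℕ+ :=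
  {k | k ∈ A ∨ greedyCount A u k.natPred + 1 ≤ u * (k.natPred + 1)}

lemma cnt_greedySuperset (A : Set ℕ+) (u : ℝ) (n : ℕ) :
    cnt (greedySuperset A u) n = greedyCount A u n := by
  classical
  induction n with
  | zero => simp [greedyCount]
  | succ n ih =>
    rw [cnt_succ, ih, greedyCount, ind, Set.indicator_apply]
    simp only [greedySuperset, Set.mem_ofPred_eq, Nat.natPred_succPNat]
    congr

/-- An accepted integer raises the count by 1 ≥ u; one is rejected only if accepting it would exceed
the budget, so the deficit is then below 1. -/
lemma le_greedyCount (A : Set ℕ+) {u : ℝ} (hu : u ≤ 1) (n : ℕ) :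
    u * n - 1 ≤ greedyCount A u n := by
  induction n with
  | zero => simp [greedyCount]
  | succ n ih =>
    rw [greedyCount]
    push_cast
    split_ifs with h
    · linarith
    · push Not at h
      linarith [h.2]

/-- Here m is the last index at which the budget condition held (or 0). The count at m is at most
um, and after m only elements of A enter. -/
lemma greedyCount_le (A : Set ℕ+) (u : ℝ) (n : ℕ) :
    ∃ m ≤ n, greedyCount A u n ≤ u * n + (cnt A n - cnt A m - u * (n - m)) := by
  classical
  induction n with
  | zero => exact ⟨0, le_rfl, by simp [greedyCount]⟩
  | succ n ih =>
    obtain ⟨m, hm, h⟩ := ih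
    by_cases hg : greedyCount A u n + 1 ≤ u * (n + 1)
    · refine ⟨n + 1, le_rfl, ?_⟩
      rw [greedyCount, if_pos (Or.inr hg)]
      push_cast
      linarith
    · refine ⟨m, hm.trans n.le_succ, ?_⟩
      rw [greedyCount, cnt_succ, ind, Set.indicator_apply]
      simp only [hg, or_false]
      push_cast
      linarith

lemma exists_superset_hasDensityValue (A : Set ℕ+) :
    ∃ B, A ⊆ B ∧ HasDensityValue B (unifDensity A) := by
  refine ⟨greedySuperset A (unifDensity A), fun k hk => Or.inl hk, fun ε hε => ?_⟩
  obtain ⟨C, hC⟩ := unifBound_unifDensity A ε hε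
  refine ⟨max C 1, fun n => ?_⟩
  have h0 : 0 ≤ ε * (n : ℝ) := by positivity
  rw [cnt_greedySuperset, abs_le]
  constructor
  · linarith [le_greedyCount A (unifDensity_le_one A) n, le_max_right C 1]
  · obtain ⟨m, hm, h⟩ := greedyCount_le A (unifDensity A) n
    linarith [hC m n hm, le_max_left C 1]

lemma isLeast_density_superset (A : Set ℕ+) :
    IsLeast {x : ℝ | ∃ B : Set ℕ+, A ⊆ B ∧ HasDensity B ∧ density B = x} (unifDensity A) := by
  constructor
  · obtain ⟨B, hAB, hB⟩ := exists_superset_hasDensityValue A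
    exact ⟨B, hAB, hasDensityValue_iff.1 hB⟩
  · rintro x ⟨B, hAB, hB⟩
    exact ((hasDensityValue_iff.2 hB).unifBound hAB).unifDensity_le

/-! ### Density measures -/

lemma IsDensityMeasure.apply_eq {μ : Set ℕ+ → ℝ} (hμ : IsDensityMeasure μ) {B : Set ℕ+} {d : ℝ}
    (h : HasDensityValue B d) : μ B = d := by
  obtain ⟨h1, rfl⟩ := hasDensityValue_iff.1 h
  exact hμ.extends_density B h1

lemma IsDensityMeasure.mono {μ : Set ℕ+ → ℝ} (hμ : IsDensityMeasure μ) {A B : Set ℕ+}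
    (h : A ⊆ B) : μ A ≤ μ B := by
  have := hμ.additive A (B \ A) Set.disjoint_sdiff_right
  rw [Set.union_sdiff_cancel h] at this
  linarith [(hμ.mem_unit (B \ A)).1]

lemma IsDensityMeasure.apply_compl {μ : Set ℕ+ → ℝ} (hμ : IsDensityMeasure μ) (A : Set ℕ+) :
    μ Aᶜ = 1 - μ A := by
  have := hμ.additive A Aᶜ disjoint_compl_right
  rw [Set.union_compl_self, hμ.apply_eq hasDensityValue_univ] at this
  linarith

lemma IsDensityMeasure.apply_le_unifDensity {μ : Set ℕ+ → ℝ} (hμ : IsDensityMeasure μ)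
    (A : Set ℕ+) : μ A ≤ unifDensity A := by
  obtain ⟨B, hAB, hB⟩ := exists_superset_hasDensityValue A
  exact (hμ.mono hAB).trans_eq (hμ.apply_eq hB)

/-- Along intervals `(m j, n j]` whose lengths tend to infinity and are not `o(n j)`, every
ultrafilter limit of the relative frequencies is a density measure. -/
lemma exists_isDensityMeasure_tendsto (U : Ultrafilter ℕ) (hU : (U : Filter ℕ) ≤ atTop)
    (m n : ℕ → ℕ) (hmn : ∀ j, m j < n j) {K : ℝ} (hK : ∀ j, (n j : ℝ) ≤ K * (n j - m j))
    (hlen : Tendsto (fun j => (n j : ℝ) - m j) atTop atTop) :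
    ∃ μ, IsDensityMeasure μ ∧
      ∀ X, Tendsto (fun j => (cnt X (n j) - cnt X (m j)) / ((n j : ℝ) - m j)) U (𝓝 (μ X)) := by
  have hpos (j : ℕ) : (0 : ℝ) < (n j : ℝ) - m j := by
    have : (m j : ℝ) < n j := by exact_mod_cast hmn j
    linarith
  have hmem (X : Set ℕ+) (j : ℕ) :
      (cnt X (n j) - cnt X (m j)) / ((n j : ℝ) - m j) ∈ Set.Icc (0 : ℝ) 1 :=
    ⟨div_nonneg (sub_nonneg.2 (cnt_mono X (hmn j).le)) (hpos j).le,
      div_le_one_of_le₀ (cnt_sub_le X (hmn j).le) (hpos j).le⟩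
  have hlim (X : Set ℕ+) : ∃ a ∈ Set.Icc (0 : ℝ) 1,
      Tendsto (fun j => (cnt X (n j) - cnt X (m j)) / ((n j : ℝ) - m j)) U (𝓝 a) :=
    -- Compactness of [0, 1] makes every ultrafilter limit exist; additivity then passes to the
    -- limit.
    isCompact_Icc.ultrafilter_le_nhds
      (U.map fun j => (cnt X (n j) - cnt X (m j)) / ((n j : ℝ) - m j))
      (by
        rw [le_principal_iff]
        exact mem_map.2 (Eventually.of_forall (hmem X)))
  choose μ hμ hμl using hlim
  refine ⟨μ, ⟨hμ, fun X Y hXY => ?_, fun X hX => ?_⟩, hμl⟩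
  · refine tendsto_nhds_unique (hμl _) (((hμl X).add (hμl Y)).congr fun j => ?_)
    rw [cnt_union hXY, cnt_union hXY]
    ring
  · have hX' : HasDensityValue X (density X) := hasDensityValue_iff.2 ⟨hX, rfl⟩
    refine tendsto_nhds_unique (hμl X) (Tendsto.mono_left ?_ hU)
    have hK0 : 0 < K := by
      have h1 : (0 : ℝ) < n 0 := by exact_mod_cast (Nat.zero_le _).trans_lt (hmn 0)
      exact pos_of_mul_pos_left (h1.trans_le (hK 0)) (hpos 0).le
    rw [Metric.tendsto_nhds]
    intro ε hε
    -- The linear errors at both endpoints are each at most (ε/4)(n - m); the remaining ε/2 pays for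
    -- the two constants C.
    obtain ⟨C, hC⟩ := hX' (ε / (4 * K)) (by positivity)
    filter_upwards [hlen.eventually_gt_atTop (2 * C / (ε / 2))] with j hj
    rw [div_lt_iff₀ (by positivity)] at hj
    have h1 := hC (n j)
    have h2 := hC (m j)
    have h3 : ε / (4 * K) * (m j : ℝ) ≤ ε / (4 * K) * n j := by
      gcongr
      exact (hmn j).le
    have h4 : ε / (4 * K) * (n j : ℝ) ≤ ε / 4 * (n j - m j) := by
      calc ε / (4 * K) * (n j : ℝ) ≤ ε / (4 * K) * (K * (n j - m j)) := by gcongr; exact hK j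
        _ = ε / 4 * (n j - m j) := by field_simp
    rw [Real.dist_eq, div_sub' (hpos j).ne', abs_div, abs_of_pos (hpos j), div_lt_iff₀ (hpos j),
      abs_lt]
    rw [abs_le] at h1 h2
    constructor <;> linarith

lemma exists_isDensityMeasure_le_apply {A : Set ℕ+} {v : ℝ} (hv1 : v < 1) (hv : ¬ UnifBound A v) :
    ∃ μ, IsDensityMeasure μ ∧ v ≤ μ A := by
  simp only [UnifBound, not_forall, not_exists, not_le] at hv
  obtain ⟨δ, hδ, h⟩ := hv
  -- Letting the violated constant be j + 1 will force the lengths to infinity.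
  choose m n hmn h using fun j : ℕ => h (j + 1)
  -- The excess is compared with the trivial bound n - m. The term δn gives K = (1 - v)/δ, and j + 1
  -- gives unbounded lengths.
  have hlen (j : ℕ) : δ * (n j : ℝ) + (j + 1) < (1 - v) * ((n j : ℝ) - m j) := by
    linarith [h j, cnt_sub_le A (hmn j)]
  have hlt (j : ℕ) : (0 : ℝ) < (n j : ℝ) - m j := by
    have h1 : 0 ≤ δ * (n j : ℝ) + (j + 1) := by positivity
    exact pos_of_mul_pos_right (h1.trans_lt (hlen j)) (by linarith)
  have hv0 : 0 < 1 - v := by linarith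
  obtain ⟨μ, hμ, hl⟩ := exists_isDensityMeasure_tendsto (hyperfilter ℕ)
    (hyperfilter_le_cofinite.trans Nat.cofinite_eq_atTop.le) m n
    (fun j => by have := hlt j; rw [sub_pos] at this; exact_mod_cast this) (K := (1 - v) / δ)
    (fun j => by
      rw [div_mul_eq_mul_div, le_div_iff₀ hδ]
      have : (0 : ℝ) ≤ j := by positivity
      linarith [hlen j])
    (by
      refine tendsto_atTop_mono (f := fun j : ℕ => (j : ℝ) / (1 - v)) (fun j => ?_)
        (tendsto_natCast_atTop_atTop.atTop_div_const hv0)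
      rw [div_le_iff₀ hv0]
      have : 0 ≤ δ * (n j : ℝ) := by positivity
      linarith [hlen j])
  refine ⟨μ, hμ, ge_of_tendsto (hl A) (Eventually.of_forall fun j => ?_)⟩
  rw [le_div_iff₀ (hlt j)]
  have : 0 ≤ δ * (n j : ℝ) := by positivity
  have : (0 : ℝ) ≤ j := by positivity
  linarith [h j]

lemma isLUB_densityMeasure (A : Set ℕ+) :
    IsLUB {x : ℝ | ∃ μ : Set ℕ+ → ℝ, IsDensityMeasure μ ∧ μ A = x} (unifDensity A) := by
  constructor
  · rintro x ⟨μ, hμ, rfl⟩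
    exact hμ.apply_le_unifDensity A
  · intro b hb
    -- Values v < 0 are included, so a measure is produced even when `unifDensity A` is 0.
    refine le_of_forall_lt fun v hv => ?_
    obtain ⟨w, hvw, hw⟩ := exists_between hv
    obtain ⟨μ, hμ, h⟩ := exists_isDensityMeasure_le_apply (hw.trans_le (unifDensity_le_one A))
      (not_unifBound_of_lt hw)
    exact hvw.trans_le (h.trans (hb ⟨μ, hμ, rfl⟩))

/-! ### Pólya density -/

lemma polyaQuotient_eq (θ : ℝ) (A : Set ℕ+) (n : ℕ+) :
    polyaQuotient θ A n = (cnt A n - cnt A ⌊θ * n⌋₊) / ((1 - θ) * n) := by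
  rw [polyaQuotient, count_eq_cnt, count_eq_cnt, Nat.floor_natCast, sub_mul, one_mul]

lemma floor_mul_le {θ : ℝ} (hθ : θ < 1) (n : ℕ) : ⌊θ * n⌋₊ ≤ n := by
  refine Nat.floor_le_of_le ?_
  exact mul_le_of_le_one_left (by positivity) hθ.le

lemma polyaQuotient_nonneg {θ : ℝ} (hθ : θ < 1) (A : Set ℕ+) (n : ℕ+) :
    0 ≤ polyaQuotient θ A n := by
  rw [polyaQuotient_eq]
  exact div_nonneg (sub_nonneg.2 (cnt_mono A (floor_mul_le hθ n)))
    (mul_nonneg (by linarith) (by positivity))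

lemma abs_polyaQuotient_le {θ : ℝ} (hθ : θ < 1) (A : Set ℕ+) (n : ℕ+) :
    |polyaQuotient θ A n| ≤ 1 / (1 - θ) := by
  have h0 : 0 < 1 - θ := by linarith
  have hn := pnat_cast_pos n
  rw [abs_of_nonneg (polyaQuotient_nonneg hθ A n), polyaQuotient_eq,
    div_le_div_iff₀ (by positivity) h0]
  have h1 := cnt_le A n
  have h2 := cnt_nonneg A ⌊θ * n⌋₊
  nlinarith

lemma upperPolya_nonneg {θ : ℝ} (hθ : θ < 1) (A : Set ℕ+) : 0 ≤ upperPolya θ A :=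
  le_limsup_of_frequently_le (Frequently.of_forall (polyaQuotient_nonneg hθ A))
    (isBoundedUnder_le_of_abs (abs_polyaQuotient_le hθ A))

lemma upperPolya_le_unifDensity {θ : ℝ} (hθ : θ < 1) (A : Set ℕ+) :
    upperPolya θ A ≤ unifDensity A := by
  have h0 : 0 < 1 - θ := by linarith
  refine limsup_le_of_forall_pos (abs_polyaQuotient_le hθ A) fun ε hε => ?_
  -- Half of ε(1 - θ)n pays for δn, the other half for C plus at most 1 lost in rounding θn.
  obtain ⟨C, hC⟩ := unifBound_unifDensity A (ε * (1 - θ) / 2) (by positivity)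
  filter_upwards [tendsto_pnat_cast.eventually_gt_atTop ((C + 1) / (ε * (1 - θ) / 2))] with n hn
  have hn0 := pnat_cast_pos n
  rw [div_lt_iff₀ (by positivity)] at hn
  rw [polyaQuotient_eq, div_le_iff₀ (by positivity)]
  have h1 := hC _ _ (floor_mul_le hθ n)
  have h2 := Nat.lt_floor_add_one (θ * n)
  have h3 : unifDensity A * ((n : ℝ) - ⌊θ * n⌋₊) ≤ unifDensity A * (n - θ * n + 1) :=
    mul_le_mul_of_nonneg_left (by linarith) (unifDensity_nonneg A)
  have h4 := unifDensity_le_one A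
  linarith

/-- Iterating n ↦ ⌊θn⌋ cuts (m, n] into blocks of relative frequency below v. Only the last,
incomplete block is counted trivially, so the error (1 - θ)n occurs once and does not accumulate. -/
lemma exists_cnt_sub_le_of_upperPolya_lt {θ v : ℝ} (hθ0 : 0 < θ) (hθ : θ < 1) (hv0 : 0 ≤ v)
    {A : Set ℕ+} (hv : upperPolya θ A < v) :
    ∃ C : ℝ, ∀ m n : ℕ, m ≤ n → cnt A n - cnt A m ≤ v * (n - m) + (1 - θ) * n + C := by
  have h0 : 0 < 1 - θ := by linarith
  obtain ⟨N, hN⟩ := eventually_atTop.1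
    (eventually_lt_of_limsup_lt hv (isBoundedUnder_le_of_abs (abs_polyaQuotient_le hθ A)))
  refine ⟨N, fun m n => ?_⟩
  have hN0 := pnat_cast_pos N
  induction n using Nat.strong_induction_on with
  | _ n ih =>
    intro hmn
    have hmn' : (m : ℝ) ≤ n := by exact_mod_cast hmn
    have hvm : 0 ≤ v * ((n : ℝ) - m) := mul_nonneg hv0 (by linarith)
    have hn0 : 0 ≤ (1 - θ) * (n : ℝ) := by positivity
    have htriv := cnt_sub_le A hmn
    rcases lt_or_ge n (N : ℕ) with hn | hn
    · have h1 : (n : ℝ) < N := by exact_mod_cast hn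
      have h2 : (0 : ℝ) ≤ m := by positivity
      linarith
    have hpos : 0 < n := N.pos.trans_le hn
    have hn1 : (0 : ℝ) < n := by exact_mod_cast hpos
    rcases lt_or_ge ⌊θ * n⌋₊ m with hm | hm
    · have h1 : θ * n < m := (Nat.floor_lt (by positivity)).1 hm
      linarith
    · have h1 : ⌊θ * n⌋₊ < n := by
        rw [Nat.floor_lt (by positivity)]
        exact mul_lt_of_lt_one_left hn1 hθ
      have h2 := ih _ h1 hm
      have h3 := hN (n.toPNat hpos) hn
      rw [polyaQuotient_eq, Nat.toPNat, PNat.mk_coe, div_lt_iff₀ (by positivity)] at h3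
      have h4 : (⌊θ * n⌋₊ : ℝ) ≤ θ * n := Nat.floor_le (by positivity)
      have h5 : v * (⌊θ * n⌋₊ : ℝ) ≤ v * (θ * n) := by gcongr
      have h6 : (1 - θ) * (⌊θ * n⌋₊ : ℝ) ≤ (1 - θ) * n := by
        gcongr
      linarith

lemma tendsto_upperPolya (A : Set ℕ+) :
    Tendsto (fun θ : ℝ => upperPolya θ A) (𝓝[<] 1) (𝓝 (unifDensity A)) := by
  have hθ : ∀ᶠ θ : ℝ in 𝓝[<] 1, 0 < θ ∧ θ < 1 := Ioo_mem_nhdsLT zero_lt_one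
  refine tendsto_order.2 ⟨fun v hv => ?_, fun v hv => ?_⟩
  · obtain ⟨w, hvw, hw⟩ := exists_between hv
    suffices h : ∀ᶠ θ : ℝ in 𝓝[<] 1, w ≤ upperPolya θ A from h.mono fun θ h => hvw.trans_le h
    rcases le_or_gt w 0 with hw0 | hw0
    · exact hθ.mono fun θ h => hw0.trans (upperPolya_nonneg h.2 A)
    -- It suffices that small values occur for θ arbitrarily close to 1: each gives the bound with
    -- error (1 - θ)n. No monotonicity in θ is needed.
    by_contra hcon
    refine not_unifBound_of_lt hw fun δ hδ => ?_
    have hδ' : ∀ᶠ θ : ℝ in 𝓝[<] 1, 1 - δ < θ ∧ θ < 1 := Ioo_mem_nhdsLT (by linarith)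
    obtain ⟨θ, h3, h1, h2⟩ := ((not_eventually.1 hcon).and_eventually (hθ.and hδ')).exists
    rw [not_le] at h3
    obtain ⟨C, hC⟩ := exists_cnt_sub_le_of_upperPolya_lt h1.1 h1.2 hw0.le h3
    refine ⟨C, fun m n hmn => (hC m n hmn).trans ?_⟩
    have : (1 - θ) * (n : ℝ) ≤ δ * n := by
      gcongr
      linarith [h2.1]
    linarith
  · exact hθ.mono fun θ h => (upperPolya_le_unifDensity h.2 A).trans_lt hv

lemma lowerPolya_eq {θ : ℝ} (hθ0 : 0 < θ) (hθ : θ < 1) (A : Set ℕ+) :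
    lowerPolya θ A = 1 - upperPolya θ Aᶜ := by
  have h0 : 0 < 1 - θ := by linarith
  refine liminf_eq_sub_limsup (abs_polyaQuotient_le hθ Aᶜ) (abs_polyaQuotient_le hθ A) ?_
  rw [Metric.tendsto_nhds]
  intro ε hε
  filter_upwards [tendsto_pnat_cast.eventually_gt_atTop (1 / (ε * (1 - θ)))] with n hn
  have hn0 := pnat_cast_pos n
  rw [div_lt_iff₀ (by positivity)] at hn
  have h1 := Nat.lt_floor_add_one (θ * n)
  have h2 : (⌊θ * n⌋₊ : ℝ) ≤ θ * n := Nat.floor_le (by positivity)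
  have h3 : 0 < (1 - θ) * (n : ℝ) := by positivity
  rw [polyaQuotient_eq, polyaQuotient_eq, ← add_div, cnt_compl, cnt_compl, Real.dist_eq,
    div_sub' h3.ne', abs_div, abs_of_pos h3, div_lt_iff₀ h3, abs_lt]
  constructor <;> linarith

/-! ### `α`-densities -/

lemma wcnt_succ (α : ℝ) (A : Set ℕ+) (n : ℕ) :
    wcnt α A (n + 1) = wcnt α A n + ind A n * ((n : ℝ) + 1) ^ α :=
  Finset.sum_range_succ _ _

lemma wcnt_nonneg (α : ℝ) (A : Set ℕ+) (n : ℕ) : 0 ≤ wcnt α A n :=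
  Finset.sum_nonneg fun k _ => mul_nonneg (ind_nonneg A k) (by positivity)

lemma wcnt_le_univ (α : ℝ) (A : Set ℕ+) (n : ℕ) : wcnt α A n ≤ wcnt α Set.univ n :=
  Finset.sum_le_sum fun k _ =>
    mul_le_mul_of_nonneg_right (ind_mono (Set.subset_univ A) k) (by positivity)

lemma wcnt_univ_pos (α : ℝ) {n : ℕ} (hn : 0 < n) : 0 < wcnt α Set.univ n := by
  refine Finset.sum_pos (fun k _ => ?_) ⟨0, Finset.mem_range.2 hn⟩
  rw [ind_univ, one_mul]
  positivity

lemma wcnt_compl (α : ℝ) (A : Set ℕ+) (n : ℕ) :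
    wcnt α Aᶜ n = wcnt α Set.univ n - wcnt α A n := by
  simp only [wcnt, ← Finset.sum_sub_distrib, ind_compl, ind_univ, sub_mul]

/-- Bernoulli's inequality gives `x ^ (α + 1) + (α + 1) x ^ α ≤ (x + 1) ^ (α + 1)`. -/
lemma rpow_succ_add_le {α : ℝ} (hα : 0 ≤ α) {x : ℝ} (hx : 0 < x) :
    x ^ (α + 1) + (α + 1) * x ^ α ≤ (x + 1) ^ (α + 1) := by
  have h := one_add_mul_self_le_rpow_one_add (s := 1 / x) (by
    have : 0 < 1 / x := by positivity
    linarith) (p := α + 1) (by linarith)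
  have h1 : (x + 1) ^ (α + 1) = x ^ (α + 1) * (1 + 1 / x) ^ (α + 1) := by
    rw [← Real.mul_rpow hx.le (by positivity)]
    congr 1
    field_simp
  have h2 : x ^ (α + 1) = x ^ α * x := Real.rpow_add_one hx.ne' α
  calc x ^ (α + 1) + (α + 1) * x ^ α = x ^ (α + 1) * (1 + (α + 1) * (1 / x)) := by
        rw [h2]
        field_simp
    _ ≤ x ^ (α + 1) * (1 + 1 / x) ^ (α + 1) := by gcongr
    _ = _ := h1.symm

/-- Bernoulli's inequality at -1/(x + 1): the power function lies above its tangent at x + 1. -/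
lemma rpow_succ_le_add {α : ℝ} (hα : 0 ≤ α) {x : ℝ} (hx : 0 ≤ x) :
    (x + 1) ^ (α + 1) ≤ x ^ (α + 1) + (α + 1) * (x + 1) ^ α := by
  have hx1 : 0 < x + 1 := by linarith
  have hle : 1 / (x + 1) ≤ 1 := by rw [div_le_one hx1]; linarith
  have h := one_add_mul_self_le_rpow_one_add (s := -(1 / (x + 1))) (by linarith)
    (p := α + 1) (by linarith)
  have h1 : x ^ (α + 1) = (x + 1) ^ (α + 1) * (1 + -(1 / (x + 1))) ^ (α + 1) := by
    rw [← Real.mul_rpow hx1.le (by linarith)]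
    congr 1
    field_simp
    ring
  have h2 : (x + 1) ^ (α + 1) = (x + 1) ^ α * (x + 1) := Real.rpow_add_one hx1.ne' α
  have h3 : (x + 1) ^ (α + 1) * (1 + (α + 1) * -(1 / (x + 1))) ≤ x ^ (α + 1) := by
    rw [h1]
    gcongr
  have h4 : (x + 1) ^ (α + 1) * (1 + (α + 1) * -(1 / (x + 1))) =
      (x + 1) ^ (α + 1) - (α + 1) * (x + 1) ^ α := by
    rw [h2]
    field_simp
    ring
  linarith

/-- Telescoping the Bernoulli estimates, here and in `wcnt_univ_le`, replaces comparison with the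
integral of x^α. -/
lemma rpow_succ_le_wcnt_univ {α : ℝ} (hα : 0 ≤ α) (n : ℕ) :
    (n : ℝ) ^ (α + 1) ≤ (α + 1) * wcnt α Set.univ n := by
  induction n with
  | zero => simp [wcnt, Real.zero_rpow (by linarith : α + 1 ≠ 0)]
  | succ n ih =>
    rw [wcnt_succ, ind_univ]
    push_cast
    linarith [rpow_succ_le_add hα (Nat.cast_nonneg (α := ℝ) n)]

lemma wcnt_univ_le {α : ℝ} (hα : 0 ≤ α) (n : ℕ) :
    (α + 1) * wcnt α Set.univ n ≤ (n : ℝ) ^ (α + 1) + (α + 1) * (n : ℝ) ^ α := by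
  induction n with
  | zero =>
    simp only [wcnt, Finset.range_zero, Finset.sum_empty, mul_zero]
    positivity
  | succ n ih =>
    rw [wcnt_succ, ind_univ]
    push_cast
    rcases Nat.eq_zero_or_pos n with rfl | hn
    · simp only [wcnt, Finset.range_zero, Finset.sum_empty, Nat.cast_zero, zero_add, Real.one_rpow]
      linarith
    · have := rpow_succ_add_le hα (x := n) (by exact_mod_cast hn)
      linarith

lemma abs_powSum_div_le (α : ℝ) (A : Set ℕ+) (n : ℕ+) :
    |powSum α A n / powSum α Set.univ n| ≤ 1 := by
  rw [powSum_eq_wcnt, powSum_eq_wcnt,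
    abs_of_nonneg (div_nonneg (wcnt_nonneg _ _ _) (wcnt_nonneg _ _ _))]
  exact div_le_one_of_le₀ (wcnt_le_univ _ _ _) (wcnt_nonneg _ _ _)

lemma upperAlphaDensity_nonneg (α : ℝ) (A : Set ℕ+) : 0 ≤ upperAlphaDensity α A := by
  refine le_limsup_of_frequently_le (Frequently.of_forall fun n => ?_)
    (isBoundedUnder_le_of_abs (abs_powSum_div_le α A))
  rw [powSum_eq_wcnt, powSum_eq_wcnt]
  exact div_nonneg (wcnt_nonneg _ _ _) (wcnt_nonneg _ _ _)

/-- Partial summation: bounded tail sums of `ind A - u` control the weighted sum. -/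
lemma wcnt_sub_le_of_tail_le {α : ℝ} (hα : 0 ≤ α) {A : Set ℕ+} {u K : ℝ} {n : ℕ}
    (h : ∀ m ≤ n, cnt A n - cnt A m ≤ u * (n - m) + K) :
    wcnt α A n - u * wcnt α Set.univ n ≤ (n : ℝ) ^ α * K := by
  -- The tail beyond m carries the constant weight m^α. Raising m by one adds (m + 1)^α - m^α to
  -- that weight, at cost at most K times this; at m = n the tail is empty. The base case needs the
  -- tail bound since 0^0 = 1.
  have key : ∀ m ≤ n, wcnt α A m - u * wcnt α Set.univ m +
      (m : ℝ) ^ α * (cnt A n - cnt A m - u * (n - m)) ≤ (m : ℝ) ^ α * K := by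
    intro m
    induction m with
    | zero =>
      intro _
      have h0 := h 0 (Nat.zero_le n)
      have : cnt A n - cnt A 0 - u * ((n : ℝ) - (0 : ℕ)) ≤ K := by linarith
      simp only [wcnt, Finset.range_zero, Finset.sum_empty, mul_zero, sub_zero, zero_add]
      exact mul_le_mul_of_nonneg_left (by simpa using this) (by positivity)
    | succ m ih =>
      intro hm
      have h1 := ih (by omega)
      have h2 := h m (by omega)
      have h3 : (m : ℝ) ^ α ≤ ((m : ℝ) + 1) ^ α := by
        gcongr
        linarith
      have h4 := mul_le_mul_of_nonneg_left
        (by linarith : cnt A n - cnt A m - u * (n - m) ≤ K) (sub_nonneg.2 h3)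
      rw [wcnt_succ, wcnt_succ, cnt_succ, ind_univ]
      push_cast
      linarith
  simpa using key n le_rfl

lemma upperAlphaDensity_le_unifDensity {α : ℝ} (hα : 0 ≤ α) (A : Set ℕ+) :
    upperAlphaDensity α A ≤ unifDensity A := by
  refine limsup_le_of_forall_pos (abs_powSum_div_le α A) fun ε hε => ?_
  -- Tail error at most εn/(α + 1), weighted by n^α, is at most ε times the full weighted count.
  obtain ⟨C, hC⟩ := unifBound_unifDensity A (ε / (2 * (α + 1))) (by positivity)
  filter_upwards [tendsto_pnat_cast.eventually_gt_atTop (|C| / (ε / (2 * (α + 1))))] with n hn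
  have hn0 := pnat_cast_pos n
  rw [div_lt_iff₀ (by positivity)] at hn
  rw [powSum_eq_wcnt, powSum_eq_wcnt, div_le_iff₀ (wcnt_univ_pos α n.pos)]
  have h1 := wcnt_sub_le_of_tail_le hα (K := ε / (α + 1) * n) (n := n) (u := unifDensity A)
    (fun m hm => by
      have h1 := hC m n hm
      have h2 : ε / (α + 1) * n =
          ε / (2 * (α + 1)) * (n : ℝ) + (n : ℝ) * (ε / (2 * (α + 1))) := by
        field_simp
        ring
      linarith [le_abs_self C])
  have h2 := rpow_succ_le_wcnt_univ hα n
  rw [Real.rpow_add_one hn0.ne'] at h2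
  have h3 : ((n : ℕ) : ℝ) ^ α * (ε / (α + 1) * n) ≤ ε * wcnt α Set.univ n := by
    calc ((n : ℕ) : ℝ) ^ α * (ε / (α + 1) * n) = ε / (α + 1) * (((n : ℕ) : ℝ) ^ α * n) := by ring
      _ ≤ ε / (α + 1) * ((α + 1) * wcnt α Set.univ n) := by gcongr
      _ = _ := by field_simp
  linarith

/-- Partial summation undoing the weights: the weighted excess over v is nonpositive, so enlarging
its divisor from n^α to (n + 1)^α only increases the quotient. Only the boundary term at m remains.
-/
lemma cnt_sub_le_of_wcnt_le {α v : ℝ} (hα : 0 ≤ α) {A : Set ℕ+} {m : ℕ} (hm : 0 < m)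
    (h : ∀ n ≥ m, wcnt α A n ≤ v * wcnt α Set.univ n) {n : ℕ} (hmn : m ≤ n) :
    cnt A n - cnt A m ≤ v * (n - m) + v * (wcnt α Set.univ m / (m : ℝ) ^ α) := by
  suffices key : cnt A n - cnt A m ≤ v * (n - m) + v * (wcnt α Set.univ m / (m : ℝ) ^ α) +
      (wcnt α A n - v * wcnt α Set.univ n) / (n : ℝ) ^ α by
    have : (wcnt α A n - v * wcnt α Set.univ n) / (n : ℝ) ^ α ≤ 0 :=
      div_nonpos_of_nonpos_of_nonneg (by linarith [h n hmn]) (by positivity)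
    linarith
  induction n, hmn using Nat.le_induction with
  | base =>
    have : 0 ≤ wcnt α A m / (m : ℝ) ^ α := div_nonneg (wcnt_nonneg _ _ _) (by positivity)
    rw [sub_div, mul_div_assoc]
    linarith
  | succ n hmn ih =>
    have hn : (0 : ℝ) < n := by exact_mod_cast hm.trans_le hmn
    have h1 : (wcnt α A n - v * wcnt α Set.univ n) / (n : ℝ) ^ α ≤
        (wcnt α A n - v * wcnt α Set.univ n) / ((n : ℝ) + 1) ^ α := by
      have h2 : (v * wcnt α Set.univ n - wcnt α A n) / ((n : ℝ) + 1) ^ α ≤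
          (v * wcnt α Set.univ n - wcnt α A n) / (n : ℝ) ^ α := by
        have := sub_nonneg.2 (h n hmn)
        gcongr
        linarith
      rw [← neg_sub (v * _), neg_div, neg_div]
      exact neg_le_neg h2
    have h3 : (wcnt α A (n + 1) - v * wcnt α Set.univ (n + 1)) / ((n : ℝ) + 1) ^ α =
        (wcnt α A n - v * wcnt α Set.univ n) / ((n : ℝ) + 1) ^ α + (ind A n - v) := by
      rw [wcnt_succ, wcnt_succ, ind_univ]
      field_simp
      ring
    rw [cnt_succ]
    push_cast
    rw [h3]
    linarith

lemma exists_cnt_sub_le_of_upperAlphaDensity_lt {α v : ℝ} (hα : 0 ≤ α) (hv0 : 0 ≤ v)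
    {A : Set ℕ+} (hv : upperAlphaDensity α A < v) :
    ∃ C : ℝ, ∀ m n : ℕ, m ≤ n → cnt A n - cnt A m ≤ v * (n - m) + v / (α + 1) * n + C := by
  obtain ⟨N, hN⟩ := eventually_atTop.1
    (eventually_lt_of_limsup_lt hv (isBoundedUnder_le_of_abs (abs_powSum_div_le α A)))
  have hN' (n : ℕ) (hn : (N : ℕ) ≤ n) : wcnt α A n ≤ v * wcnt α Set.univ n := by
    have h1 := (hN (n.toPNat (N.pos.trans_le hn)) hn).le
    rwa [powSum_eq_wcnt, powSum_eq_wcnt, Nat.toPNat, PNat.mk_coe,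
      div_le_iff₀ (wcnt_univ_pos α (N.pos.trans_le hn))] at h1
  have hlarge (m n : ℕ) (hm : (N : ℕ) ≤ m) (hmn : m ≤ n) :
      cnt A n - cnt A m ≤ v * (n - m) + v / (α + 1) * n + v := by
    have hm0 : 0 < m := N.pos.trans_le hm
    have hm1 : (0 : ℝ) < m := by exact_mod_cast hm0
    have h1 := cnt_sub_le_of_wcnt_le hα hm0 (fun k hk => hN' k (hm.trans hk)) hmn
    -- This boundary term is the source of the error vn/(α + 1), which vanishes as α grows.
    have h2 : wcnt α Set.univ m / (m : ℝ) ^ α ≤ m / (α + 1) + 1 := by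
      have h3 := wcnt_univ_le hα m
      rw [Real.rpow_add_one hm1.ne'] at h3
      rw [div_le_iff₀ (by positivity), ← mul_le_mul_iff_right₀ (by positivity : 0 < α + 1)]
      refine h3.trans_eq ?_
      field_simp
    have h3 : v * (wcnt α Set.univ m / (m : ℝ) ^ α) ≤ v * (n / (α + 1) + 1) := by
      refine mul_le_mul_of_nonneg_left (h2.trans ?_) hv0
      gcongr
    have h4 : v * ((n : ℝ) / (α + 1) + 1) = v / (α + 1) * n + v := by ring
    linarith
  -- The part of (m, n] below N is counted trivially, at cost at most N.
  refine ⟨v + N, fun m n hmn => ?_⟩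
  have hN0 := pnat_cast_pos N
  have hmn' : (m : ℝ) ≤ n := by exact_mod_cast hmn
  have hvm : 0 ≤ v * ((n : ℝ) - m) := mul_nonneg hv0 (by linarith)
  have hvn : 0 ≤ v / (α + 1) * (n : ℝ) := by positivity
  rcases le_or_gt (N : ℕ) m with hm | hm
  · linarith [hlarge m n hm hmn]
  · rcases le_or_gt (N : ℕ) n with hn | hn
    · have h1 := hlarge N n le_rfl hn
      have h2 := cnt_sub_le A hm.le
      have h3 : v * (m : ℝ) ≤ v * N := by gcongr
      have h4 : (0 : ℝ) ≤ m := by positivity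
      linarith
    · have h1 := cnt_sub_le A hmn
      have h2 : (n : ℝ) < N := by exact_mod_cast hn
      have h4 : (0 : ℝ) ≤ m := by positivity
      linarith

lemma tendsto_upperAlphaDensity (A : Set ℕ+) :
    Tendsto (fun α : ℝ => upperAlphaDensity α A) atTop (𝓝 (unifDensity A)) := by
  refine tendsto_order.2 ⟨fun v hv => ?_, fun v hv => ?_⟩
  · obtain ⟨w, hvw, hw⟩ := exists_between hv
    suffices h : ∀ᶠ α : ℝ in atTop, w ≤ upperAlphaDensity α A from h.mono fun _ h => hvw.trans_le h
    rcases le_or_gt w 0 with hw0 | hw0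
    · exact Eventually.of_forall fun α => hw0.trans (upperAlphaDensity_nonneg α A)
    by_contra hcon
    refine not_unifBound_of_lt hw fun δ hδ => ?_
    obtain ⟨α, h1, h2⟩ := ((not_eventually.1 hcon).and_eventually
      ((eventually_ge_atTop 0).and (eventually_ge_atTop (w / δ)))).exists
    rw [not_le] at h1
    obtain ⟨C, hC⟩ := exists_cnt_sub_le_of_upperAlphaDensity_lt h2.1 hw0.le h1
    refine ⟨C, fun m n hmn => (hC m n hmn).trans ?_⟩
    have h3 := h2.2
    have h4 := h2.1
    rw [div_le_iff₀ hδ] at h3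
    have : w / (α + 1) * (n : ℝ) ≤ δ * n := by
      gcongr
      rw [div_le_iff₀ (by linarith)]
      linarith
    linarith
  · filter_upwards [eventually_ge_atTop 0] with α hα
    exact (upperAlphaDensity_le_unifDensity hα A).trans_lt hv

lemma lowerAlphaDensity_eq (α : ℝ) (A : Set ℕ+) :
    lowerAlphaDensity α A = 1 - upperAlphaDensity α Aᶜ := by
  refine liminf_eq_sub_limsup (abs_powSum_div_le α Aᶜ) (abs_powSum_div_le α A) ?_
  refine tendsto_const_nhds.congr fun n => ?_
  rw [powSum_eq_wcnt, powSum_eq_wcnt, powSum_eq_wcnt, wcnt_compl, ← add_div, sub_add_cancel,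
    div_self (wcnt_univ_pos α n.pos).ne']

/-! ### The lower densities, by passing to complements -/

lemma isGLB_densityMeasure (A : Set ℕ+) :
    IsGLB {x : ℝ | ∃ μ : Set ℕ+ → ℝ, IsDensityMeasure μ ∧ μ A = x} (1 - unifDensity Aᶜ) := by
  have h := isLUB_densityMeasure Aᶜ
  constructor
  · rintro x ⟨μ, hμ, rfl⟩
    have := h.1 ⟨μ, hμ, rfl⟩
    rw [hμ.apply_compl] at this
    linarith
  · intro b hb
    have : unifDensity Aᶜ ≤ 1 - b := h.2 (by
      rintro x ⟨μ, hμ, rfl⟩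
      have := hb ⟨μ, hμ, rfl⟩
      rw [hμ.apply_compl]
      linarith)
    linarith

lemma isGreatest_density_subset (A : Set ℕ+) :
    IsGreatest {x : ℝ | ∃ B : Set ℕ+, B ⊆ A ∧ HasDensity B ∧ density B = x}
      (1 - unifDensity Aᶜ) := by
  constructor
  · obtain ⟨B, hAB, hB⟩ := exists_superset_hasDensityValue Aᶜ
    exact ⟨Bᶜ, Set.compl_subset_comm.1 hAB, hasDensityValue_iff.1 hB.compl⟩
  · rintro x ⟨B, hBA, hB⟩
    have := ((hasDensityValue_iff.2 hB).compl.unifBound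
      (Set.compl_subset_compl.2 hBA)).unifDensity_le
    linarith

lemma tendsto_lowerPolya (A : Set ℕ+) :
    Tendsto (fun θ : ℝ => lowerPolya θ A) (𝓝[<] 1) (𝓝 (1 - unifDensity Aᶜ)) := by
  have hθ : ∀ᶠ θ : ℝ in 𝓝[<] 1, 0 < θ ∧ θ < 1 := Ioo_mem_nhdsLT zero_lt_one
  exact ((tendsto_upperPolya Aᶜ).const_sub 1).congr'
    (hθ.mono fun θ h => (lowerPolya_eq h.1 h.2 A).symm)

lemma tendsto_lowerAlphaDensity (A : Set ℕ+) :
    Tendsto (fun α : ℝ => lowerAlphaDensity α A) atTop (𝓝 (1 - unifDensity Aᶜ)) :=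
  ((tendsto_upperAlphaDensity Aᶜ).const_sub 1).congr fun α => (lowerAlphaDensity_eq α A).symm

end DensityMeasure

end

theorem theorem4 (A : Set ℕ+) :
    (∃ u : ℝ,
      IsLUB {x : ℝ | ∃ μ : Set ℕ+ → ℝ, DensityMeasure.IsDensityMeasure μ ∧ μ A = x} u ∧
      IsGLB {x : ℝ | ∃ B : Set ℕ+,
        A ⊆ B ∧ DensityMeasure.HasDensity B ∧ DensityMeasure.density B = x} u ∧
      Tendsto (fun α : ℝ => DensityMeasure.upperAlphaDensity α A) atTop (𝓝 u) ∧
      Tendsto (fun θ : ℝ => DensityMeasure.upperPolya θ A) (𝓝[<] 1) (𝓝 u)) ∧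
    (∃ l : ℝ,
      IsGLB {x : ℝ | ∃ μ : Set ℕ+ → ℝ, DensityMeasure.IsDensityMeasure μ ∧ μ A = x} l ∧
      IsLUB {x : ℝ | ∃ B : Set ℕ+,
        B ⊆ A ∧ DensityMeasure.HasDensity B ∧ DensityMeasure.density B = x} l ∧
      Tendsto (fun α : ℝ => DensityMeasure.lowerAlphaDensity α A) atTop (𝓝 l) ∧
      Tendsto (fun θ : ℝ => DensityMeasure.lowerPolya θ A) (𝓝[<] 1) (𝓝 l)) :=
  ⟨⟨DensityMeasure.unifDensity A, DensityMeasure.isLUB_densityMeasure A,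
      (DensityMeasure.isLeast_density_superset A).isGLB,
      DensityMeasure.tendsto_upperAlphaDensity A, DensityMeasure.tendsto_upperPolya A⟩,
    ⟨1 - DensityMeasure.unifDensity Aᶜ, DensityMeasure.isGLB_densityMeasure A,
      (DensityMeasure.isGreatest_density_subset A).isLUB,
      DensityMeasure.tendsto_lowerAlphaDensity A, DensityMeasure.tendsto_lowerPolya A⟩⟩
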